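/- For $x\in\mathbb R$ let $\exp_0x=x$, $\exp_{n+1}x=\exp(\exp_nx)$, and for large $x$ let $\log_0x=x$, $\log_{n+1}x=\log(\log_nx)$. For a meromorphic function $f$ on $\mathbb C$ with Nevanlinna characteristic $T(r,f)$, the $(p,q)$-order is $$\rho_f(p,q)=\limsup_{r\to\infty}\frac{\log_pT(r,f)}{\log_qr}\in[0,\infty].$$ For $S\subset[0,\infty)$ the upper logarithmic density is $\overline{\log\mathrm{dens}}\,S=\limsup_{r\to\infty}\frac1{\log r}\int_{S\cap[1,r]}\frac{dt}{t}$. Let $p,q$ be integers with $p=q=1$ or $p\ge q\ge2$, and let $\rho>0$. There is a function $\delta_0:[0,\infty]\to(0,\infty)$, depending only on $p,q,\rho$, such that the following holds. Let $k\ge0$, let $c_0=0$, let $c_1,\dots,c_k$ be distinct nonzero complex numbers, and let $A_0,\dots,A_k$ be entire functions with $\max_{0\le j\le k}\rho_{A_j}(p,q)\le\rho$. Let $D\subset\mathbb C$ satisfy $\overline{\log\mathrm{dens}}\{|z|:z\in D\}>0$, and suppose that for some $l\in\{0,\dots,k\}$, some constants $0\le b<a$ and some $\delta$ with $0<\delta<\rho$,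 $$|A_l(z)|\ge\exp_p\!\big[a(\log_{q-1}|z|)^{\rho-\delta}\big],\qquad |A_j(z)|\le\exp_p\!\big[b(\log_{q-1}|z|)^{\rho-\delta}\big]\quad(0\le j\le k,\ j\ne l)$$ for all $z\in D$ with $|z|$ sufficiently large. Then every meromorphic solution $f\not\equiv0$ of $$A_k(z)f(z+c_k)+\dots+A_1(z)f(z+c_1)+A_0(z)f(z)=0$$ for which $\delta$ is sufficiently small, namely $\delta<\delta_0(\rho_f(p,q))$, satisfies (i) $\rho_f(1,1)\ge\rho_{A_l}(1,1)+1$ if $p=q=1$; (ii) $\rho_f(p,q)\ge\rho_{A_l}(p,q)$ if $p\ge q\ge2$. In particular, if the hypotheses hold for arbitrarily small $\delta>0$ (with $D$, $a$, $b$ possibly depending on $\delta$), then (i) and (ii) hold for every meromorphic solution $f\not\equiv0$. -/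

import Mathlib

/-!
The heart of the matter is a pointwise bound for shift quotients: for `0 ≤ θ < 1`,
`log |f (z + a) / f (z + b)| ≤ max 1 (T (16 * |z|)) * |z| ^ (-θ)` as soon as `|z|` avoids a set of
finite logarithmic measure, where `T` is the characteristic of `f`. Divide out the zeros and poles
`u` of `f` in a disk of radius comparable to `|z|`. The Poisson formula for the remaining harmonic
function contributes `O (T (16 * |z|) * log |z| / |z|)`. Since `log (1 + x) ≤ x ^ β / β`, the zeros
and poles contribute a sum of terms of size `| |z| - |u - a| | ^ (-β)` and
`| |z| - |u - b| | ^ (-β)`. For `θ < β < 1` these kernels are integrable in `|z|`, so Chebyshev's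
inequality on dyadic intervals makes the exceptional set small.

A set of positive upper logarithmic density contains arbitrarily large radii outside the exceptional
set. There the equation forces `|A_l(z)| ≤ ∑_{j ≠ l} |A_j(z)| * |f (z + c_j) / f (z + c_l)|`, so
`T (16 * r)` cannot grow more slowly than `r ^ θ * exp_{p-1} (a * (log_{q-1} r) ^ (ρ - δ))`, where
the factor `r ^ θ` matters only for `p = q = 1`. The order of `f` is therefore at least `ρ - δ`, or
`ρ + 1 - δ` if `p = q = 1`. An order less than `ρ`, or `ρ + 1`, is less by a positive amount, which
serves as `δ₀`.
-/

open Filter Topology MeasureTheory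

/-- The iterated exponential `exp_p`, with `exp_0 x = x`. -/
noncomputable def iterExp (p : ℕ) (x : ℝ) : ℝ := Real.exp^[p] x

/-- The iterated logarithm `log_p`, with `log_0 x = x`; only used for large arguments. -/
noncomputable def iterLog (p : ℕ) (x : ℝ) : ℝ := Real.log^[p] x

/-- The `(p,q)`-order `limsup_{r → ∞} log_p T(r,f) / log_q r` of a meromorphic function on the
plane, where `T(r,f)` is the Nevanlinna characteristic (for the value `∞`). The value is taken in
the extended reals; rational functions get order `0` by the same formula when `p ≥ q ≥ 1`. -/
noncomputable def pqOrder (p q : ℕ) (f : ℂ → ℂ) : EReal :=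
  limsup (fun r : ℝ =>
    ((iterLog p (ValueDistribution.characteristic f ⊤ r) / iterLog q r : ℝ) : EReal)) atTop

/-- The logarithmic measure `∫_{S ∩ [1,∞)} dt / t`. -/
noncomputable def logMeasure (S : Set ℝ) : ENNReal :=
  ∫⁻ t in S ∩ Set.Ici 1, ENNReal.ofReal t⁻¹

/-- The upper logarithmic density `limsup_{r → ∞} lm (S ∩ [1,r]) / log r`. -/
noncomputable def upperLogDensity (S : Set ℝ) : ENNReal :=
  limsup (fun r : ℝ => logMeasure (S ∩ Set.Icc 1 r) / ENNReal.ofReal (Real.log r)) atTop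

/-- `f` satisfies `∑ j, A j (z) * f (z + c j) = 0` as an identity of meromorphic functions, that is,
off a closed discrete subset of the plane (values at poles carry no meaning). -/
def IsDifferenceSolution {k : ℕ} (A : Fin (k + 1) → ℂ → ℂ) (c : Fin (k + 1) → ℂ)
    (f : ℂ → ℂ) : Prop :=
  Meromorphic f ∧ (fun z => ∑ j, A j z * f (z + c j)) =ᶠ[codiscrete ℂ] 0

/-- The growth condition at infinity along `D`: one coefficient `A l` is bounded below by
`exp_p (a (log_{q-1} |z|)^s)`, all others are bounded above by `exp_p (b (log_{q-1} |z|)^s)`. -/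
def DominantOn {k : ℕ} (p q : ℕ) (A : Fin (k + 1) → ℂ → ℂ) (l : Fin (k + 1)) (D : Set ℂ)
    (a b s : ℝ) : Prop :=
  ∀ᶠ z in Bornology.cobounded ℂ ⊓ 𝓟 D,
    iterExp p (a * iterLog (q - 1) ‖z‖ ^ s) ≤ ‖A l z‖ ∧
      ∀ j, j ≠ l → ‖A j z‖ ≤ iterExp p (b * iterLog (q - 1) ‖z‖ ^ s)

section PoissonJensen

open Metric Real MeromorphicOn

theorem norm_herglotzRieszKernel_sub_le {c z w₁ w₂ : ℂ} {r : ℝ} (h₁ : ‖w₁ - c‖ ≤ r)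
    (h₂ : ‖w₂ - c‖ ≤ r) (hr : r < ‖z - c‖) :
    ‖herglotzRieszKernel c w₁ z - herglotzRieszKernel c w₂ z‖ ≤
      2 * ‖z - c‖ * ‖w₁ - w₂‖ / (‖z - c‖ - r) ^ 2 := by
  have hdist {w : ℂ} (hw : ‖w - c‖ ≤ r) : ‖z - c‖ - r ≤ ‖z - w‖ := by
    have := norm_sub_norm_le (z - c) (w - c)
    rw [sub_sub_sub_cancel_right] at this
    linarith
  have hne {w : ℂ} (hw : ‖w - c‖ ≤ r) : z - c - (w - c) ≠ 0 := by
    rw [sub_sub_sub_cancel_right, ← norm_pos_iff]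
    exact (sub_pos.2 hr).trans_le (hdist hw)
  have hdiff : herglotzRieszKernel c w₁ z - herglotzRieszKernel c w₂ z =
      2 * (z - c) * (w₁ - w₂) / ((z - w₁) * (z - w₂)) := by
    have e₁ := hne h₁
    have e₂ := hne h₂
    rw [← sub_sub_sub_cancel_right z w₁ c, ← sub_sub_sub_cancel_right z w₂ c,
      ← sub_sub_sub_cancel_right w₁ w₂ c]
    simp only [herglotzRieszKernel_def]
    field_simp
    ring
  rw [hdiff, norm_div, norm_mul, norm_mul, norm_mul, Complex.norm_ofNat, pow_two]
  have := sub_pos.2 hr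
  gcongr
  exacts [hdist h₁, hdist h₂]

theorem abs_sub_le_mul_circleAverage_abs {h : ℂ → ℝ} {c w₁ w₂ : ℂ} {r R : ℝ} (hrR : r < R)
    (hh : InnerProductSpace.HarmonicOnNhd h (closedBall c R)) (h₁ : ‖w₁ - c‖ ≤ r)
    (h₂ : ‖w₂ - c‖ ≤ r) :
    |h w₁ - h w₂| ≤
      2 * R * ‖w₁ - w₂‖ / (R - r) ^ 2 * circleAverage (fun z ↦ |h z|) c R := by
  have hR : 0 < R := ((norm_nonneg _).trans h₁).trans_lt hrR
  have hball {w : ℂ} (hw : ‖w - c‖ ≤ r) : w ∈ ball c R := mem_ball_iff_norm.2 (hw.trans_lt hrR)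
  have hcont : ContinuousOn h (sphere c R) := hh.continuousOn.mono sphere_subset_closedBall
  have hint {w : ℂ} (hw : ‖w - c‖ ≤ r) :
      CircleIntegrable ((Complex.re ∘ herglotzRieszKernel c w) • h) c R := by
    have hker := continuousOn_herglotzRieszKernel_sphere (hball hw)
    rw [abs_of_pos hR] at hker
    exact ((Complex.continuous_re.comp_continuousOn hker).smul hcont).circleIntegrable hR.le
  rw [← hh.circleAverage_re_herglotzRieszKernel_smul (hball h₁),
    ← hh.circleAverage_re_herglotzRieszKernel_smul (hball h₂),
    ← circleAverage_sub (hint h₁) (hint h₂), ← smul_eq_mul, ← circleAverage_fun_smul]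
  refine abs_circleAverage_le_circleAverage_abs.trans <| circleAverage_mono
    ((hint h₁).sub (hint h₂)).abs (hcont.circleIntegrable hR.le).abs.const_smul fun z hz ↦ ?_
  have hz : ‖z - c‖ = R := by rwa [abs_of_pos hR, mem_sphere_iff_norm] at hz
  calc |(herglotzRieszKernel c w₁ z).re * h z - (herglotzRieszKernel c w₂ z).re * h z|
      = |(herglotzRieszKernel c w₁ z - herglotzRieszKernel c w₂ z).re| * |h z| := by
        rw [← sub_mul, abs_mul, Complex.sub_re]
    _ ≤ 2 * R * ‖w₁ - w₂‖ / (R - r) ^ 2 * |h z| := by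
        gcongr
        rw [← hz]
        exact (Complex.abs_re_le_norm _).trans
          (norm_herglotzRieszKernel_sub_le h₁ h₂ (hz.symm ▸ hrR))

theorem circleAverage_abs_log_norm_sub_le {c u : ℂ} {R : ℝ} (hR : 1 ≤ R)
    (hu : u ∈ closedBall c R) :
    circleAverage (fun z ↦ |log ‖z - u‖|) c R ≤ 2 * log (2 * R) := by
  have hR₀ : 0 < R := by linarith
  have hint : CircleIntegrable (fun z ↦ log ‖z - u‖) c R := circleIntegrable_log_norm_sub_const R
  have hint' : CircleIntegrable (fun z ↦ |log ‖z - u‖|) c R := hint.abs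
  have hle : circleAverage (fun z ↦ |log ‖z - u‖| + log ‖z - u‖) c R ≤ 2 * log (2 * R) := by
    refine circleAverage_mono_on_of_le_circle (hint'.add hint) fun z hz ↦ ?_
    rw [abs_of_pos hR₀, mem_sphere_iff_norm] at hz
    have hzu : ‖z - u‖ ≤ 2 * R := by
      rw [mem_closedBall, dist_comm, dist_eq_norm] at hu
      linarith [norm_sub_le_norm_sub_add_norm_sub z c u]
    have hlog : log ‖z - u‖ ≤ log (2 * R) := by
      rcases (norm_nonneg (z - u)).eq_or_lt with h₀ | h₀
      · rw [← h₀, log_zero]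
        exact log_nonneg (by linarith)
      · exact log_le_log h₀ hzu
    have : 0 ≤ log (2 * R) := log_nonneg (by linarith)
    rcases abs_cases (log ‖z - u‖) with ⟨h, -⟩ | ⟨h, -⟩ <;> linarith
  rw [circleAverage_fun_add hint' hint, circleAverage_log_norm_sub_const_of_mem_closedBall
    (by rwa [abs_of_pos hR₀])] at hle
  linarith [log_nonneg hR]

/-- The order of `f` at `u`, as a real number: positive at zeros, negative at poles, and `0` where
`f` vanishes identically near `u` or is not meromorphic. -/
noncomputable def realOrder (f : ℂ → ℂ) (u : ℂ) : ℝ := (meromorphicOrderAt f u).untop₀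

/-- The zeros and poles of `f` in the closed disk of radius `R` around `c`. Compactness makes this
a finite set when `f` is meromorphic. -/
noncomputable def zerosPoles (f : ℂ → ℂ) (c : ℂ) (R : ℝ) : Finset ℂ :=
  ((divisor f (closedBall c R)).finiteSupport (isCompact_closedBall c R)).toFinset

variable {f : ℂ → ℂ} {c : ℂ} {R : ℝ}

theorem mem_closedBall_of_mem_zerosPoles {u : ℂ} (hu : u ∈ zerosPoles f c R) :
    u ∈ closedBall c R :=
  (divisor f (closedBall c R)).supportWithinDomain ((Set.Finite.mem_toFinset _).1 hu)

theorem finsum_eq_sum_zerosPoles {M : Type*} [AddCommMonoid M] {φ : ℂ → M}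
    (hφ : ∀ u, divisor f (closedBall c R) u = 0 → φ u = 0) :
    ∑ᶠ u, φ u = ∑ u ∈ zerosPoles f c R, φ u :=
  finsum_eq_sum_of_support_subset _ fun u hu ↦
    (Set.Finite.mem_toFinset _).2 fun h ↦ hu (hφ u h)

theorem exists_log_norm_eq_sum_add_log_norm (hf : MeromorphicOn f (closedBall c R))
    (hf₀ : ∀ u ∈ closedBall c R, meromorphicOrderAt f u ≠ ⊤) :
    ∃ g : ℂ → ℂ, AnalyticOnNhd ℂ g (closedBall c R) ∧ (∀ u ∈ closedBall c R, g u ≠ 0) ∧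
      (∀ w ∈ ball c R, AnalyticAt ℂ f w → f w ≠ 0 → log ‖f w‖ =
        ∑ u ∈ zerosPoles f c R, realOrder f u * log ‖w - u‖ + log ‖g w‖) ∧
      ∀ᶠ z in codiscreteWithin (closedBall c R), log ‖f z‖ =
        ∑ u ∈ zerosPoles f c R, realOrder f u * log ‖z - u‖ + log ‖g z‖ := by
  set D := divisor f (closedBall c R)
  have hD {u : ℂ} (hu : u ∈ zerosPoles f c R) : (D u : ℝ) = realOrder f u := by
    rw [divisor_apply hf (mem_closedBall_of_mem_zerosPoles hu), realOrder]
  have hfin : D.support.Finite := D.finiteSupport (isCompact_closedBall c R)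
  obtain ⟨g, hg, hg₀, hfg⟩ := hf.extract_zeros_poles (fun u ↦ hf₀ u u.2) hfin
  refine ⟨g, hg, fun u hu ↦ hg₀ ⟨u, hu⟩, fun w hw ha hne ↦ ?_, ?_⟩
  · have hw' := ball_subset_closedBall hw
    have hacc : AccPt w (𝓟 (closedBall c R)) := accPt_iff_frequently_nhdsNE.2 <|
      (eventually_nhdsWithin_of_eventually_nhds (closedBall_mem_nhds_of_mem hw)).frequently
    have hlog := log_norm_meromorphicTrailingCoeffAt_extract_zeros_poles hfin hw' hacc
      (hf w hw') (hg w hw') (hg₀ ⟨w, hw'⟩) hfg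
    rw [ha.meromorphicTrailingCoeffAt_of_ne_zero hne, finsum_eq_sum_zerosPoles
      (f := f) (c := c) (R := R) fun u h ↦ by simp only [D, h, Int.cast_zero, zero_mul]] at hlog
    rw [hlog, Finset.sum_congr rfl fun u hu ↦ by rw [hD hu]]
  · filter_upwards [extract_zeros_poles_log hg₀ hfg] with z hz
    rw [hz, finsum_eq_sum_zerosPoles (f := f) (c := c) (R := R)
      fun u h ↦ by ext; simp only [h, Int.cast_zero, zero_mul, Pi.zero_apply]]
    simp only [Pi.add_apply, Finset.sum_apply]
    rw [Finset.sum_congr rfl fun u hu ↦ by rw [hD hu]]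

theorem circleAverage_abs_log_norm_le_of_eventuallyEq {g : ℂ → ℂ} (hR : 1 ≤ R)
    (hf : MeromorphicOn f (closedBall c R))
    (hfg : ∀ᶠ z in codiscreteWithin (closedBall c R), log ‖f z‖ =
      ∑ u ∈ zerosPoles f c R, realOrder f u * log ‖z - u‖ + log ‖g z‖) :
    circleAverage (fun z ↦ |log ‖g z‖|) c R ≤ circleAverage (fun z ↦ |log ‖f z‖|) c R +
      2 * log (2 * R) * ∑ u ∈ zerosPoles f c R, |realOrder f u| := by
  have hR₀ : 0 < R := by linarith
  have hsub : sphere c |R| ⊆ closedBall c R := by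
    rw [abs_of_pos hR₀]
    exact sphere_subset_closedBall
  have hf' : CircleIntegrable (fun z ↦ log ‖f z‖) c R :=
    circleIntegrable_log_norm fun z hz ↦ hf z (hsub hz)
  have hf'' : CircleIntegrable (fun z ↦ |log ‖f z‖|) c R := hf'.abs
  have hu (u : ℂ) : CircleIntegrable (fun z ↦ log ‖z - u‖) c R :=
    circleIntegrable_log_norm_sub_const R
  have hu' (u : ℂ) : CircleIntegrable (fun z ↦ |realOrder f u| * |log ‖z - u‖|) c R :=
    (hu u).abs.const_smul
  have hg : (fun z ↦ |log ‖g z‖|) =ᶠ[codiscreteWithin (sphere c |R|)] fun z ↦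
      |log ‖f z‖ - ∑ u ∈ zerosPoles f c R, realOrder f u * log ‖z - u‖| := by
    filter_upwards [codiscreteWithin_mono hsub hfg] with z hz
    rw [hz, add_sub_cancel_left]
  calc circleAverage (fun z ↦ |log ‖g z‖|) c R
      = circleAverage (fun z ↦
          |log ‖f z‖ - ∑ u ∈ zerosPoles f c R, realOrder f u * log ‖z - u‖|) c R :=
        circleAverage_congr_codiscreteWithin hg hR₀.ne'
    _ ≤ circleAverage (fun z ↦
          |log ‖f z‖| + ∑ u ∈ zerosPoles f c R, |realOrder f u| * |log ‖z - u‖|) c R := by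
        refine circleAverage_mono (hf'.sub (.fun_sum _ fun u _ ↦ (hu u).const_smul)).abs
          (hf''.add (.fun_sum _ fun u _ ↦ hu' u)) fun z _ ↦ (abs_sub _ _).trans ?_
        gcongr
        simpa only [abs_mul] using Finset.abs_sum_le_sum_abs
          (fun u ↦ realOrder f u * log ‖z - u‖) (zerosPoles f c R)
    _ = circleAverage (fun z ↦ |log ‖f z‖|) c R + ∑ u ∈ zerosPoles f c R,
          |realOrder f u| * circleAverage (fun z ↦ |log ‖z - u‖|) c R := by
        rw [circleAverage_fun_add hf'' (.fun_sum _ fun u _ ↦ hu' u),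
          circleAverage_fun_sum fun u _ ↦ hu' u]
        simp only [← smul_eq_mul, circleAverage_fun_smul]
    _ ≤ _ := by
        rw [mul_comm (2 * log (2 * R)), Finset.sum_mul]
        gcongr with u hu
        exact circleAverage_abs_log_norm_sub_le hR (mem_closedBall_of_mem_zerosPoles hu)

theorem log_norm_sub_log_norm_le (hf : MeromorphicOn f (closedBall c R))
    (hf₀ : ∀ u ∈ closedBall c R, meromorphicOrderAt f u ≠ ⊤) {r : ℝ} (hrR : r < R) (hR : 1 ≤ R)
    {w₁ w₂ : ℂ} (h₁ : ‖w₁ - c‖ ≤ r) (h₂ : ‖w₂ - c‖ ≤ r)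
    (ha₁ : AnalyticAt ℂ f w₁) (hw₁ : f w₁ ≠ 0) (ha₂ : AnalyticAt ℂ f w₂) (hw₂ : f w₂ ≠ 0) :
    log ‖f w₁‖ - log ‖f w₂‖ ≤
      ∑ u ∈ zerosPoles f c R, |realOrder f u| * |log ‖w₁ - u‖ - log ‖w₂ - u‖| +
      2 * R * ‖w₁ - w₂‖ / (R - r) ^ 2 * (circleAverage (fun z ↦ |log ‖f z‖|) c R +
        2 * log (2 * R) * ∑ u ∈ zerosPoles f c R, |realOrder f u|) := by
  have hball {w : ℂ} (hw : ‖w - c‖ ≤ r) : w ∈ ball c R := mem_ball_iff_norm.2 (hw.trans_lt hrR)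
  obtain ⟨g, hg, hg₀, hval, hfg⟩ := exists_log_norm_eq_sum_add_log_norm hf hf₀
  have hosc := abs_sub_le_mul_circleAverage_abs hrR
    (fun z hz ↦ (hg z hz).harmonicAt_log_norm (hg₀ z hz)) h₁ h₂
  have havg := circleAverage_abs_log_norm_le_of_eventuallyEq hR hf hfg
  have hsum : ∑ u ∈ zerosPoles f c R, realOrder f u * log ‖w₁ - u‖ -
      ∑ u ∈ zerosPoles f c R, realOrder f u * log ‖w₂ - u‖ ≤
      ∑ u ∈ zerosPoles f c R, |realOrder f u| * |log ‖w₁ - u‖ - log ‖w₂ - u‖| := by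
    simp only [← Finset.sum_sub_distrib, ← mul_sub, ← abs_mul]
    exact Finset.sum_le_sum fun u _ ↦ le_abs_self _
  have hg_le := (le_abs_self _).trans
    (hosc.trans (mul_le_mul_of_nonneg_left havg (by positivity)))
  rw [hval w₁ (hball h₁) ha₁ hw₁, hval w₂ (hball h₂) ha₂ hw₂]
  linarith

open ValueDistribution in
theorem circleAverage_abs_log_norm_eq_proximity_add (hf : Meromorphic f) (R : ℝ) :
    circleAverage (fun z ↦ |log ‖f z‖|) 0 R = proximity f ⊤ R + proximity f 0 R := by
  rw [proximity_top, proximity_zero_of_complexValued, ← circleAverage_fun_add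
    (circleIntegrable_posLog_norm fun z _ ↦ hf z)
    (circleIntegrable_posLog_norm fun z _ ↦ hf.inv z)]
  congr 1 with z
  rw [Pi.inv_apply, norm_inv, posLog_apply, posLog_apply, log_inv, max_comm 0, max_comm 0,
    max_zero_add_max_neg_zero_eq_abs_self]

end PoissonJensen

section Counting

open Metric Real MeromorphicOn ValueDistribution

open scoped Classical in
theorem sum_mul_log_sub_log_le_logCounting {E : Type*} [NormedAddCommGroup E] [ProperSpace E]
    {D : Function.locallyFinsupp E ℤ} (hD : 0 ≤ D) {r R : ℝ} (hr : 1 ≤ r) (hrR : r ≤ R)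
    {s : Finset E} (hs : ∀ u ∈ s, ‖u‖ ≤ r) :
    (∑ u ∈ s, (D u : ℝ)) * (log R - log r) ≤ D.logCounting R := by
  have hsum_le : ∑ u ∈ s, Function.locallyFinsuppWithin.single u (D u) ≤ D := fun x ↦ by
    rw [Function.locallyFinsuppWithin.coe_sum, Finset.sum_apply]
    simp only [Function.locallyFinsuppWithin.single_apply, Finset.sum_ite_eq]
    split_ifs
    exacts [le_rfl, hD x]
  refine le_trans ?_ (Function.locallyFinsuppWithin.logCounting_le hsum_le (hr.trans hrR))
  rw [map_sum, Finset.sum_apply, Finset.sum_mul]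
  refine Finset.sum_le_sum fun u hu ↦ ?_
  rw [Function.locallyFinsuppWithin.logCounting_single_eq_log_sub_const ((hs u hu).trans hrR)]
  have hlog : log ‖u‖ ≤ log r := by
    rcases (norm_nonneg u).eq_or_lt with h | h
    · rw [← h, log_zero]
      exact log_nonneg hr
    · exact log_le_log h (hs u hu)
  have : (0 : ℝ) ≤ D u := Int.cast_nonneg (hD u)
  gcongr

variable {f : ℂ → ℂ}

theorem sum_abs_realOrder_mul_log_sub_log_le (hf : Meromorphic f) {r R : ℝ} (hr : 1 ≤ r)
    (hrR : r ≤ R) :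
    (∑ u ∈ zerosPoles f 0 r, |realOrder f u|) * (log R - log r) ≤
      logCounting f 0 R + logCounting f ⊤ R := by
  set D := divisor f Set.univ
  have hD (u : ℂ) : |realOrder f u| = ((D⁺ + D⁻) u : ℤ) := by
    rw [realOrder, ← divisor_apply (fun z _ ↦ hf z) (Set.mem_univ u), ← Int.cast_abs]
    exact congrArg _ (posPart_add_negPart (D u)).symm
  have hcount := sum_mul_log_sub_log_le_logCounting
    (add_nonneg (posPart_nonneg D) (negPart_nonneg D)) hr hrR
    fun u hu ↦ mem_closedBall_zero_iff.1 (mem_closedBall_of_mem_zerosPoles (f := f) hu)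
  rwa [map_add, Pi.add_apply, ← Finset.sum_congr rfl fun u _ ↦ hD u, ← logCounting_zero,
    ← logCounting_top] at hcount

theorem characteristic_inv_le (hf : Meromorphic f) {R : ℝ} (hR : R ≠ 0) :
    characteristic f⁻¹ ⊤ R ≤
      characteristic f ⊤ R + |log ‖meromorphicTrailingCoeffAt f 0‖| := by
  have := characteristic_sub_characteristic_inv_of_ne_zero hf hR
  linarith [neg_abs_le (log ‖meromorphicTrailingCoeffAt f 0‖)]

theorem circleAverage_abs_log_norm_le_characteristic (hf : Meromorphic f) {R : ℝ} (hR : 1 ≤ R) :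
    circleAverage (fun z ↦ |log ‖f z‖|) 0 R ≤
      2 * characteristic f ⊤ R + |log ‖meromorphicTrailingCoeffAt f 0‖| := by
  have h : proximity f ⊤ R ≤ characteristic f ⊤ R :=
    le_add_of_nonneg_right (logCounting_nonneg hR)
  have h_inv : proximity f⁻¹ ⊤ R ≤ characteristic f⁻¹ ⊤ R :=
    le_add_of_nonneg_right (logCounting_nonneg hR)
  rw [circleAverage_abs_log_norm_eq_proximity_add hf, ← proximity_inv]
  linarith [characteristic_inv_le hf (R := R) (by linarith)]

theorem sum_abs_realOrder_mul_log_sub_log_le_characteristic (hf : Meromorphic f) {r R : ℝ}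
    (hr : 1 ≤ r) (hrR : r ≤ R) :
    (∑ u ∈ zerosPoles f 0 r, |realOrder f u|) * (log R - log r) ≤
      2 * characteristic f ⊤ R + |log ‖meromorphicTrailingCoeffAt f 0‖| := by
  have h : logCounting f ⊤ R ≤ characteristic f ⊤ R :=
    le_add_of_nonneg_left (proximity_nonneg R)
  have h_inv : logCounting f⁻¹ ⊤ R ≤ characteristic f⁻¹ ⊤ R :=
    le_add_of_nonneg_left (proximity_nonneg R)
  have hcount := sum_abs_realOrder_mul_log_sub_log_le hf hr hrR
  rw [← logCounting_inv] at hcount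
  linarith [characteristic_inv_le hf (R := R) (by linarith)]

theorem exists_circleAverage_and_sum_le_mul (hf : Meromorphic f) :
    ∃ K : ℝ, 0 < K ∧ ∀ R τ : ℝ, 1 ≤ R → 1 ≤ τ → characteristic f ⊤ (2 * R) ≤ τ →
      circleAverage (fun z ↦ |log ‖f z‖|) 0 R ≤ K * τ ∧
        ∑ u ∈ zerosPoles f 0 R, |realOrder f u| ≤ K * τ := by
  set κ := |log ‖meromorphicTrailingCoeffAt f 0‖|
  have hκ : 0 ≤ κ := abs_nonneg _
  have hlog : 0 < log 2 := log_pos one_lt_two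
  refine ⟨(2 + κ) / log 2, by positivity, fun R τ hR hτ hT ↦ ?_⟩
  have hT' : characteristic f ⊤ R ≤ τ := (characteristic_monotoneOn hf
    (show 0 < R by linarith) (show 0 < 2 * R by linarith) (by linarith)).trans hT
  have hκτ : κ ≤ κ * τ := le_mul_of_one_le_right hκ hτ
  have hcount := sum_abs_realOrder_mul_log_sub_log_le_characteristic hf hR
    (show R ≤ 2 * R by linarith)
  rw [log_mul two_ne_zero (by linarith), add_sub_cancel_right] at hcount
  refine ⟨(circleAverage_abs_log_norm_le_characteristic hf hR).trans ?_, ?_⟩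
  · calc 2 * characteristic f ⊤ R + κ ≤ (2 + κ) * τ := by linarith
      _ ≤ (2 + κ) / log 2 * τ := by
        gcongr
        exact le_div_self (by linarith) hlog (by linarith [log_two_lt_d9])
  · rw [div_mul_eq_mul_div, le_div_iff₀ hlog]
    linarith

end Counting

section LogarithmicMeasure

/-- The measure `dt / t` on `[1, ∞)`, whose values are those of `logMeasure`. -/
noncomputable def logarithmicMeasure : Measure ℝ :=
  (volume.restrict (Set.Ici 1)).withDensity fun t ↦ ENNReal.ofReal t⁻¹

/-- The filter of properties of `z : ℂ` that hold whenever `‖z‖` avoids a suitable set of finite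
logarithmic measure. -/
noncomputable def offFiniteLogMeasure : Filter ℂ := comap norm logarithmicMeasure.cofinite

theorem logMeasure_eq_logarithmicMeasure (S : Set ℝ) : logMeasure S = logarithmicMeasure S := by
  rw [logarithmicMeasure, withDensity_apply', Measure.restrict_restrict' measurableSet_Ici,
    logMeasure]

theorem logarithmicMeasure_le_mul_volume {S : Set ℝ} {x : ℝ} (hx : 0 < x) (hS : S ⊆ Set.Ici x) :
    logarithmicMeasure S ≤ ENNReal.ofReal x⁻¹ * volume S := by
  rw [← logMeasure_eq_logarithmicMeasure]
  calc logMeasure S ≤ ∫⁻ t in S, ENNReal.ofReal t⁻¹ := lintegral_mono_set Set.inter_subset_left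
    _ ≤ ∫⁻ _ in S, ENNReal.ofReal x⁻¹ := setLIntegral_mono measurable_const fun t ht ↦
        ENNReal.ofReal_le_ofReal (inv_anti₀ hx (hS ht))
    _ = ENNReal.ofReal x⁻¹ * volume S := setLIntegral_const _ _

theorem logarithmicMeasure_absolutelyContinuous : logarithmicMeasure ≪ volume :=
  (withDensity_absolutelyContinuous _ _).trans Measure.absolutelyContinuous_restrict

theorem logarithmicMeasure_Iic_lt_top (x : ℝ) : logarithmicMeasure (Set.Iic x) < ⊤ := by
  have hsubset : Set.Iic x ∩ Set.Ici 1 ⊆ Set.Icc 1 x := fun _ h ↦ ⟨h.2, h.1⟩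
  calc logarithmicMeasure (Set.Iic x) = logarithmicMeasure (Set.Iic x ∩ Set.Ici 1) := by
        simp only [← logMeasure_eq_logarithmicMeasure, logMeasure, Set.inter_assoc, Set.inter_self]
    _ ≤ logarithmicMeasure (Set.Icc 1 x) := measure_mono hsubset
    _ ≤ ENNReal.ofReal 1⁻¹ * volume (Set.Icc 1 x) :=
        logarithmicMeasure_le_mul_volume one_pos Set.Icc_subset_Ici_self
    _ < ⊤ := ENNReal.mul_lt_top ENNReal.ofReal_lt_top measure_Icc_lt_top

theorem upperLogDensity_eq_zero {S : Set ℝ} (hS : logarithmicMeasure S < ⊤) :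
    upperLogDensity S = 0 := by
  have hlim : Tendsto (fun r : ℝ ↦ logarithmicMeasure S / ENNReal.ofReal (Real.log r))
      atTop (𝓝 0) := by
    simpa only [ENNReal.div_top, Function.comp_def] using ENNReal.Tendsto.const_div
      (ENNReal.tendsto_ofReal_atTop.comp Real.tendsto_log_atTop) (Or.inr hS.ne)
  refine le_antisymm ?_ zero_le
  rw [← hlim.limsup_eq]
  refine limsup_le_limsup (Eventually.of_forall fun r ↦ ENNReal.div_le_div_right ?_ _)
  rw [logMeasure_eq_logarithmicMeasure]
  exact measure_mono Set.inter_subset_left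

theorem offFiniteLogMeasure_le_cobounded : offFiniteLogMeasure ≤ Bornology.cobounded ℂ := by
  rw [offFiniteLogMeasure, ← comap_norm_atTop]
  refine comap_mono (le_iInf fun x ↦ le_principal_iff.2 (Measure.mem_cofinite.2 ?_))
  rw [Set.compl_Ici]
  exact (measure_mono Set.Iio_subset_Iic_self).trans_lt (logarithmicMeasure_Iic_lt_top x)

theorem eventually_offFiniteLogMeasure_norm_ne {S : Set ℂ} (hS : S.Countable) (c : ℂ) :
    ∀ᶠ z in offFiniteLogMeasure, ∀ u ∈ S, ‖z‖ ≠ ‖u - c‖ := by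
  have hnull : logarithmicMeasure ((fun u ↦ ‖u - c‖) '' S) = 0 :=
    logarithmicMeasure_absolutelyContinuous ((hS.image _).measure_zero _)
  have hmem : ((fun u ↦ ‖u - c‖) '' S)ᶜ ∈ logarithmicMeasure.cofinite :=
    Measure.compl_mem_cofinite.2 (hnull.trans_lt ENNReal.zero_lt_top)
  filter_upwards [preimage_mem_comap hmem] with z hz u hu heq
  exact hz ⟨u, hu, heq.symm⟩

theorem countable_compl_of_mem_codiscrete {X : Type*} [TopologicalSpace X]
    [SecondCountableTopology X] {s : Set X} (hs : s ∈ codiscrete X) : sᶜ.Countable := by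
  have := isDiscrete_iff_discreteTopology.1 (mem_codiscrete'.1 hs).2
  exact Set.countable_coe_iff.1 (TopologicalSpace.separableSpace_iff_countable.1 inferInstance)

theorem offFiniteLogMeasure_le_codiscrete : offFiniteLogMeasure ≤ codiscrete ℂ := fun s hs ↦ by
  filter_upwards [eventually_offFiniteLogMeasure_norm_ne
    (countable_compl_of_mem_codiscrete hs) 0] with z hz
  by_contra hzs
  exact hz z hzs (by rw [sub_zero])

theorem neBot_offFiniteLogMeasure_inf_principal {D : Set ℂ}
    (hD : 0 < upperLogDensity (norm '' D)) : (offFiniteLogMeasure ⊓ 𝓟 D).NeBot := by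
  refine inf_principal_neBot_iff.2 fun U hU ↦ ?_
  obtain ⟨t, ht, htU⟩ := mem_comap.1 hU
  by_contra hempty
  have hsub : norm '' D ⊆ tᶜ := by
    rintro _ ⟨z, hz, rfl⟩ hzt
    exact hempty ⟨z, htU hzt, hz⟩
  exact hD.ne' (upperLogDensity_eq_zero ((measure_mono hsub).trans_lt (Measure.mem_cofinite.1 ht)))

theorem eventually_offFiniteLogMeasure_of_dyadic {P : ℂ → Prop} {S : ℝ → Set ℝ} {C ε : ℝ}
    (hε : 0 < ε) (hS : ∀ R, 1 ≤ R → logarithmicMeasure (S R) ≤ ENNReal.ofReal (C * R ^ (-ε)))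
    (hP : ∀ᶠ R in atTop, ∀ z : ℂ, ‖z‖ ∈ Set.Icc R (2 * R) → ‖z‖ ∉ S R → P z) :
    ∀ᶠ z in offFiniteLogMeasure, P z := by
  have hpow (m : ℕ) : (1 : ℝ) ≤ 2 ^ m := one_le_pow₀ one_le_two
  have hgeom (m : ℕ) : ((2 : ℝ) ^ m) ^ (-ε) = ((2 : ℝ) ^ (-ε)) ^ m := by
    rw [← Real.rpow_natCast, ← Real.rpow_mul zero_le_two, mul_comm, Real.rpow_mul zero_le_two,
      Real.rpow_natCast]
  have hsummable : Summable fun m : ℕ ↦ C * ((2 : ℝ) ^ m) ^ (-ε) := by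
    simp only [hgeom]
    exact (summable_geometric_of_lt_one (by positivity)
      (Real.rpow_lt_one_of_one_lt_of_neg one_lt_two (neg_lt_zero.2 hε))).mul_left C
  have hfin : logarithmicMeasure (⋃ m : ℕ, S (2 ^ m)) < ⊤ :=
    calc logarithmicMeasure (⋃ m : ℕ, S (2 ^ m))
        ≤ ∑' m : ℕ, logarithmicMeasure (S (2 ^ m)) := measure_iUnion_le _
      _ ≤ ∑' m : ℕ, ENNReal.ofReal (C * ((2 : ℝ) ^ m) ^ (-ε)) :=
        ENNReal.tsum_le_tsum fun m ↦ hS _ (hpow m)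
      _ < ⊤ := hsummable.tsum_ofReal_lt_top
  obtain ⟨R₀, hR₀⟩ := eventually_atTop.1 hP
  filter_upwards [preimage_mem_comap (Measure.compl_mem_cofinite.2 hfin),
    (tendsto_norm_cobounded_atTop.mono_left offFiniteLogMeasure_le_cobounded).eventually_ge_atTop
      (max 1 (2 * R₀))] with z hzS hz
  obtain ⟨m, hm, hm'⟩ := exists_nat_pow_near ((le_max_left _ _).trans hz) one_lt_two
  rw [pow_succ'] at hm'
  exact hR₀ (2 ^ m) (by linarith [le_max_right 1 (2 * R₀)]) z ⟨hm, hm'.le⟩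
    fun h ↦ hzS (Set.mem_iUnion_of_mem m h)

end LogarithmicMeasure

section RieszPotential

variable {β : ℝ}

theorem log_one_add_le_rpow_div {t : ℝ} (ht : 0 ≤ t) (hβ : 0 < β) (hβ₁ : β ≤ 1) :
    Real.log (1 + t) ≤ t ^ β / β := by
  have hadd : (1 + t) ^ β ≤ 1 + t ^ β := by
    simpa only [Real.one_rpow] using Real.rpow_add_le_add_rpow zero_le_one ht hβ.le hβ₁
  have hlog : Real.log ((1 + t) ^ β) ≤ (1 + t) ^ β - 1 :=
    Real.log_le_sub_one_of_pos (by positivity)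
  rw [Real.log_rpow (by linarith)] at hlog
  rw [le_div_iff₀' hβ]
  linarith

theorem log_sub_log_le_rpow {x y d : ℝ} (hx : 0 < x) (hy : 0 < y) (hd : |x - y| ≤ d)
    (hβ : 0 < β) (hβ₁ : β ≤ 1) :
    Real.log x - Real.log y ≤ d ^ β / β * y ^ (-β) := by
  have hd₀ : 0 ≤ d := (abs_nonneg _).trans hd
  calc Real.log x - Real.log y = Real.log (x / y) := (Real.log_div hx.ne' hy.ne').symm
    _ ≤ Real.log (1 + d / y) := by
      refine Real.log_le_log (div_pos hx hy) ?_
      rw [← div_self hy.ne', ← add_div]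
      gcongr
      linarith [le_abs_self (x - y)]
    _ ≤ (d / y) ^ β / β := log_one_add_le_rpow_div (div_nonneg hd₀ hy.le) hβ hβ₁
    _ = d ^ β / β * y ^ (-β) := by
      rw [Real.div_rpow hd₀ hy.le, Real.rpow_neg hy.le]
      ring

theorem abs_log_sub_log_le_rpow {x y d : ℝ} (hx : 0 < x) (hy : 0 < y) (hd : |x - y| ≤ d)
    (hβ : 0 < β) (hβ₁ : β ≤ 1) :
    |Real.log x - Real.log y| ≤ d ^ β / β * (x ^ (-β) + y ^ (-β)) := by
  have hd₀ : 0 ≤ d := (abs_nonneg _).trans hd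
  have hx' : 0 ≤ d ^ β / β * x ^ (-β) := by positivity
  have hy' : 0 ≤ d ^ β / β * y ^ (-β) := by positivity
  have hxy := log_sub_log_le_rpow hx hy hd hβ hβ₁
  have hyx := log_sub_log_le_rpow hy hx (abs_sub_comm x y ▸ hd) hβ hβ₁
  rw [mul_add, abs_le]
  constructor <;> linarith

theorem lintegral_rpow_neg_Ioc {ℓ : ℝ} (hℓ : 0 ≤ ℓ) (hβ₁ : β < 1) :
    ∫⁻ x in Set.Ioc 0 ℓ, ENNReal.ofReal (x ^ (-β)) = ENNReal.ofReal (ℓ ^ (1 - β) / (1 - β)) := by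
  have hint : IntervalIntegrable (fun x : ℝ ↦ x ^ (-β)) volume 0 ℓ :=
    intervalIntegral.intervalIntegrable_rpow' (by linarith)
  rw [← ofReal_integral_eq_lintegral_ofReal
      ((intervalIntegrable_iff_integrableOn_Ioc_of_le hℓ).1 hint)
      ((ae_restrict_iff' measurableSet_Ioc).2 <| .of_forall fun x hx ↦ Real.rpow_nonneg hx.1.le _),
    ← intervalIntegral.integral_of_le hℓ, integral_rpow (Or.inl (by linarith)),
    Real.zero_rpow (by linarith), sub_zero, neg_add_eq_sub]

theorem ofReal_abs_rpow_neg_le_add_indicator {ℓ : ℝ} (hℓ : 0 < ℓ) (hβ : 0 < β) (y : ℝ) :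
    ENNReal.ofReal (|y| ^ (-β)) ≤ ENNReal.ofReal (ℓ ^ (-β)) +
      ((Set.Ioc 0 ℓ).indicator (fun x ↦ ENNReal.ofReal (x ^ (-β))) y +
        (Set.Ioc 0 ℓ).indicator (fun x ↦ ENNReal.ofReal (x ^ (-β))) (-y)) := by
  rcases lt_or_ge ℓ |y| with hy | hy
  · exact le_add_right (ENNReal.ofReal_le_ofReal
      (Real.rpow_le_rpow_of_nonpos hℓ hy.le (neg_nonpos.2 hβ.le)))
  have hmem {x : ℝ} (hx : x ∈ Set.Ioc 0 ℓ) : ENNReal.ofReal (x ^ (-β)) ≤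
      (Set.Ioc 0 ℓ).indicator (fun x ↦ ENNReal.ofReal (x ^ (-β))) x := by
    rw [Set.indicator_of_mem hx]
  refine le_add_left ?_
  rcases lt_trichotomy y 0 with h | rfl | h
  · rw [abs_of_neg h] at hy ⊢
    exact le_add_left (hmem ⟨neg_pos.2 h, hy⟩)
  · rw [abs_zero, Real.zero_rpow (neg_ne_zero.2 hβ.ne'), ENNReal.ofReal_zero]
    exact zero_le
  · rw [abs_of_pos h] at hy ⊢
    exact le_add_right (hmem ⟨h, hy⟩)

theorem lintegral_abs_sub_rpow_neg_le {a b : ℝ} (hab : a < b) (hβ : 0 < β) (hβ₁ : β < 1)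
    (t : ℝ) :
    ∫⁻ x in Set.Icc a b, ENNReal.ofReal (|x - t| ^ (-β)) ≤
      ENNReal.ofReal ((1 + 2 / (1 - β)) * (b - a) ^ (1 - β)) := by
  set ℓ := b - a
  have hℓ : 0 < ℓ := sub_pos.2 hab
  have : 0 < 1 - β := sub_pos.2 hβ₁
  set φ : ℝ → ENNReal := (Set.Ioc 0 ℓ).indicator fun x ↦ ENNReal.ofReal (x ^ (-β))
  have hφ : Measurable φ := Measurable.indicator (by fun_prop) measurableSet_Ioc
  have hφint : ∫⁻ x, φ x = ENNReal.ofReal (ℓ ^ (1 - β) / (1 - β)) := by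
    rw [lintegral_indicator measurableSet_Ioc, lintegral_rpow_neg_Ioc hℓ.le hβ₁]
  calc ∫⁻ x in Set.Icc a b, ENNReal.ofReal (|x - t| ^ (-β))
      ≤ ∫⁻ x in Set.Icc a b, (ENNReal.ofReal (ℓ ^ (-β)) + (φ (x - t) + φ (t - x))) :=
        lintegral_mono fun x ↦ by
          simpa only [neg_sub] using ofReal_abs_rpow_neg_le_add_indicator hℓ hβ (x - t)
    _ = ENNReal.ofReal (ℓ ^ (-β)) * ENNReal.ofReal ℓ +
        ∫⁻ x in Set.Icc a b, (φ (x - t) + φ (t - x)) := by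
        rw [lintegral_add_left measurable_const, setLIntegral_const, Real.volume_Icc]
    _ ≤ ENNReal.ofReal (ℓ ^ (-β)) * ENNReal.ofReal ℓ + ∫⁻ x, (φ (x - t) + φ (t - x)) := by
        gcongr
        exact Measure.restrict_le_self
    _ = ENNReal.ofReal (ℓ ^ (-β) * ℓ + (ℓ ^ (1 - β) / (1 - β) + ℓ ^ (1 - β) / (1 - β))) := by
        rw [lintegral_add_left (by fun_prop), lintegral_sub_right_eq_self φ t,
          lintegral_sub_left_eq_self φ t, hφint, ← ENNReal.ofReal_mul (by positivity),
          ← ENNReal.ofReal_add (by positivity) (by positivity),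
          ← ENNReal.ofReal_add (by positivity) (by positivity)]
    _ = ENNReal.ofReal ((1 + 2 / (1 - β)) * ℓ ^ (1 - β)) := by
        rw [← Real.rpow_add_one hℓ.ne', neg_add_eq_sub]
        ring_nf

theorem lintegral_sum_mul_abs_sub_rpow_neg_le {κ : Type*} {s : Finset κ} {w : κ → ℝ}
    (hw : ∀ u ∈ s, 0 ≤ w u) (t : κ → ℝ) {a b : ℝ} (hab : a < b) (hβ : 0 < β) (hβ₁ : β < 1) :
    ∫⁻ r in Set.Icc a b, ENNReal.ofReal (∑ u ∈ s, w u * |r - t u| ^ (-β)) ≤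
      ENNReal.ofReal ((∑ u ∈ s, w u) * ((1 + 2 / (1 - β)) * (b - a) ^ (1 - β))) :=
  calc ∫⁻ r in Set.Icc a b, ENNReal.ofReal (∑ u ∈ s, w u * |r - t u| ^ (-β))
      = ∫⁻ r in Set.Icc a b, ∑ u ∈ s, ENNReal.ofReal (w u) *
          ENNReal.ofReal (|r - t u| ^ (-β)) := by
        refine lintegral_congr fun r ↦ ?_
        rw [ENNReal.ofReal_sum_of_nonneg fun u hu ↦ mul_nonneg (hw u hu) (by positivity)]
        exact Finset.sum_congr rfl fun u hu ↦ ENNReal.ofReal_mul (hw u hu)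
    _ = ∑ u ∈ s, ENNReal.ofReal (w u) *
          ∫⁻ r in Set.Icc a b, ENNReal.ofReal (|r - t u| ^ (-β)) := by
        rw [lintegral_finsetSum _ fun u _ ↦ by fun_prop]
        exact Finset.sum_congr rfl fun u _ ↦ lintegral_const_mul _ (by fun_prop)
    _ ≤ ∑ u ∈ s, ENNReal.ofReal (w u) *
          ENNReal.ofReal ((1 + 2 / (1 - β)) * (b - a) ^ (1 - β)) := by
        gcongr with u
        exact lintegral_abs_sub_rpow_neg_le hab hβ hβ₁ (t u)
    _ = ENNReal.ofReal ((∑ u ∈ s, w u) * ((1 + 2 / (1 - β)) * (b - a) ^ (1 - β))) := by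
        rw [← Finset.sum_mul, ← ENNReal.ofReal_sum_of_nonneg hw,
          ENNReal.ofReal_mul (Finset.sum_nonneg hw)]

theorem volume_setOf_le_sum_mul_rpow_neg_le {κ : Type*} {s : Finset κ} {w : κ → ℝ}
    (hw : ∀ u ∈ s, 0 ≤ w u) (t : κ → ℝ) {a b v : ℝ} (hab : a < b) (hβ : 0 < β) (hβ₁ : β < 1)
    (hv : 0 < v) :
    volume {r ∈ Set.Icc a b | v ≤ ∑ u ∈ s, w u * |r - t u| ^ (-β)} ≤
      ENNReal.ofReal ((∑ u ∈ s, w u) * ((1 + 2 / (1 - β)) * (b - a) ^ (1 - β)) / v) := by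
  set Q : ℝ → ℝ := fun r ↦ ∑ u ∈ s, w u * |r - t u| ^ (-β)
  have hQ : Measurable Q := by fun_prop
  calc volume {r ∈ Set.Icc a b | v ≤ Q r}
      = volume ({r | v ≤ Q r} ∩ Set.Icc a b) := by rw [Set.inter_comm]; rfl
    _ ≤ volume.restrict (Set.Icc a b) {r | v ≤ Q r} := Measure.le_restrict_apply _ _
    _ ≤ volume.restrict (Set.Icc a b) {r | ENNReal.ofReal v ≤ ENNReal.ofReal (Q r)} :=
        measure_mono fun _ ↦ ENNReal.ofReal_le_ofReal
    _ ≤ (∫⁻ r in Set.Icc a b, ENNReal.ofReal (Q r)) / ENNReal.ofReal v :=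
        meas_ge_le_lintegral_div hQ.ennreal_ofReal.aemeasurable
          (ENNReal.ofReal_pos.2 hv).ne' ENNReal.ofReal_ne_top
    _ ≤ ENNReal.ofReal ((∑ u ∈ s, w u) * ((1 + 2 / (1 - β)) * (b - a) ^ (1 - β)) / v) := by
        rw [ENNReal.ofReal_div_of_pos hv]
        gcongr
        exact lintegral_sum_mul_abs_sub_rpow_neg_le hw t hab hβ hβ₁

end RieszPotential

section Shift

open Metric MeromorphicOn ValueDistribution

/-- The Riesz potential of order `β` at `r` of the zeros and poles of `f` in the closed disk of
radius `R` around `0`, counted with multiplicity and projected to the real line by their distance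
to `a`. It bounds the oscillation of `log ‖f‖` caused by these points on the circle of radius `r`
around `a`. -/
noncomputable def radialPotential (f : ℂ → ℂ) (R β : ℝ) (a : ℂ) (r : ℝ) : ℝ :=
  ∑ u ∈ zerosPoles f 0 R, |realOrder f u| * |r - ‖u - a‖| ^ (-β)

variable {f : ℂ → ℂ} {β : ℝ} {a b : ℂ}

theorem logarithmicMeasure_setOf_le_radialPotential_le (f : ℂ → ℂ) (a : ℂ) {r R v : ℝ}
    (hr : 0 < r) (hβ : 0 < β) (hβ₁ : β < 1) (hv : 0 < v) :
    logarithmicMeasure {t ∈ Set.Icc r (2 * r) | v ≤ radialPotential f R β a t} ≤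
      ENNReal.ofReal
        ((∑ u ∈ zerosPoles f 0 R, |realOrder f u|) * (1 + 2 / (1 - β)) * r ^ (-β) / v) := by
  have hvol := volume_setOf_le_sum_mul_rpow_neg_le (s := zerosPoles f 0 R)
    (fun u _ ↦ abs_nonneg (realOrder f u)) (fun u ↦ ‖u - a‖) (show r < 2 * r by linarith) hβ hβ₁ hv
  refine (logarithmicMeasure_le_mul_volume hr fun t ht ↦ ht.1.1).trans
    ((mul_le_mul_right hvol _).trans_eq ?_)
  rw [← ENNReal.ofReal_mul (inv_nonneg.2 hr.le), two_mul, add_sub_cancel_right,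
    show (1 - β : ℝ) = -β + 1 by ring, Real.rpow_add_one hr.ne']
  field_simp

theorem eventually_codiscrete_analyticAt_and_ne_zero (hf : Meromorphic f)
    (hf₀ : ∀ z, meromorphicOrderAt f z ≠ ⊤) :
    ∀ᶠ z in codiscrete ℂ, AnalyticAt ℂ f z ∧ f z ≠ 0 := by
  rw [Filter.Eventually, mem_codiscrete]
  intro z
  rw [disjoint_principal_right, compl_compl]
  exact (hf z).eventually_analyticAt.and
    ((meromorphicOrderAt_ne_top_iff_eventually_ne_zero (hf z)).1 (hf₀ z))

theorem eventually_analyticAt_and_ne_zero_on_sphere (hf : Meromorphic f)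
    (hf₀ : ∀ z, meromorphicOrderAt f z ≠ ⊤) (a : ℂ) :
    ∀ᶠ z in offFiniteLogMeasure, ∀ u ∈ sphere a ‖z‖, AnalyticAt ℂ f u ∧ f u ≠ 0 := by
  filter_upwards [eventually_offFiniteLogMeasure_norm_ne (countable_compl_of_mem_codiscrete
    (eventually_codiscrete_analyticAt_and_ne_zero hf hf₀)) a] with z hz u hu
  by_contra hnot
  exact hz u hnot (mem_sphere_iff_norm.1 hu).symm

theorem eq_zero_of_mem_zerosPoles {c u : ℂ} {R : ℝ} (hu : u ∈ zerosPoles f c R)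
    (ha : AnalyticAt ℂ f u) : f u = 0 := by
  by_contra hne
  have hord : meromorphicOrderAt f u = 0 := by
    rw [ha.meromorphicOrderAt_eq, ha.analyticOrderAt_eq_zero.2 hne, ENat.map_zero, Nat.cast_zero,
      WithTop.coe_zero]
  refine (Set.Finite.mem_toFinset _).1 hu ?_
  rw [divisor_def, hord, WithTop.untop₀_zero, ite_self]

theorem abs_norm_sub_norm_sub_le (z a u : ℂ) : |‖z‖ - ‖u - a‖| ≤ ‖z + a - u‖ := by
  rw [← sub_sub_eq_add_sub]
  exact abs_norm_sub_norm_le z (u - a)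

theorem abs_norm_sub_norm_sub_pos {z u : ℂ} {R : ℝ}
    (ha : ∀ u ∈ sphere a ‖z‖, AnalyticAt ℂ f u ∧ f u ≠ 0) (hu : u ∈ zerosPoles f 0 R) :
    0 < |‖z‖ - ‖u - a‖| := by
  refine abs_pos.2 (sub_ne_zero.2 fun heq ↦ ?_)
  have h := ha u (mem_sphere_iff_norm.2 heq.symm)
  exact h.2 (eq_zero_of_mem_zerosPoles hu h.1)

theorem sum_abs_realOrder_mul_abs_log_sub_le {z : ℂ} (R : ℝ) (hβ : 0 < β) (hβ₁ : β ≤ 1)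
    (ha : ∀ u ∈ sphere a ‖z‖, AnalyticAt ℂ f u ∧ f u ≠ 0)
    (hb : ∀ u ∈ sphere b ‖z‖, AnalyticAt ℂ f u ∧ f u ≠ 0) :
    ∑ u ∈ zerosPoles f 0 R,
        |realOrder f u| * |Real.log ‖z + a - u‖ - Real.log ‖z + b - u‖| ≤
      ‖a - b‖ ^ β / β * (radialPotential f R β a ‖z‖ + radialPotential f R β b ‖z‖) := by
  rw [radialPotential, radialPotential, ← Finset.sum_add_distrib, Finset.mul_sum]
  refine Finset.sum_le_sum fun u hu ↦ ?_
  rw [← mul_add, mul_left_comm]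
  have hpos_a := abs_norm_sub_norm_sub_pos ha hu
  have hpos_b := abs_norm_sub_norm_sub_pos hb hu
  have hle_a := abs_norm_sub_norm_sub_le z a u
  have hle_b := abs_norm_sub_norm_sub_le z b u
  have hdist : |‖z + a - u‖ - ‖z + b - u‖| ≤ ‖a - b‖ := by
    simpa only [sub_sub_sub_cancel_right, add_sub_add_left_eq_sub] using
      abs_norm_sub_norm_le (z + a - u) (z + b - u)
  gcongr
  refine (abs_log_sub_log_le_rpow (hpos_a.trans_le hle_a) (hpos_b.trans_le hle_b) hdist
    hβ hβ₁).trans ?_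
  have hβ' : -β ≤ 0 := neg_nonpos.2 hβ.le
  gcongr ?_ * (?_ + ?_)
  exacts [Real.rpow_le_rpow_of_nonpos hpos_a hle_a hβ',
    Real.rpow_le_rpow_of_nonpos hpos_b hle_b hβ']

theorem log_norm_shift_sub_le (hf : Meromorphic f) (hf₀ : ∀ z, meromorphicOrderAt f z ≠ ⊤)
    {z : ℂ} {R : ℝ} (hβ : 0 < β) (hβ₁ : β ≤ 1) (hR : 1 ≤ R) (haR : ‖z‖ + ‖a‖ ≤ R / 2)
    (hbR : ‖z‖ + ‖b‖ ≤ R / 2) (ha : ∀ u ∈ sphere a ‖z‖, AnalyticAt ℂ f u ∧ f u ≠ 0)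
    (hb : ∀ u ∈ sphere b ‖z‖, AnalyticAt ℂ f u ∧ f u ≠ 0) :
    Real.log ‖f (z + a)‖ - Real.log ‖f (z + b)‖ ≤
      ‖a - b‖ ^ β / β * (radialPotential f R β a ‖z‖ + radialPotential f R β b ‖z‖) +
        8 * ‖a - b‖ / R * (Real.circleAverage (fun z ↦ |Real.log ‖f z‖|) 0 R +
          2 * Real.log (2 * R) * ∑ u ∈ zerosPoles f 0 R, |realOrder f u|) := by
  have hball {e : ℂ} (he : ‖z‖ + ‖e‖ ≤ R / 2) : ‖z + e - 0‖ ≤ R / 2 := by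
    rw [sub_zero]
    exact (norm_add_le z e).trans he
  have hmem (e : ℂ) : z + e ∈ sphere e ‖z‖ := by rw [mem_sphere_iff_norm, add_sub_cancel_right]
  have hcoeff : 2 * R * ‖z + a - (z + b)‖ / (R - R / 2) ^ 2 = 8 * ‖a - b‖ / R := by
    rw [add_sub_add_left_eq_sub]
    have : R ≠ 0 := by linarith
    field_simp
    ring
  have hquot := log_norm_sub_log_norm_le hf.meromorphicOn (fun u _ ↦ hf₀ u)
    (show R / 2 < R by linarith) hR (hball haR) (hball hbR) (ha _ (hmem a)).1 (ha _ (hmem a)).2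
    (hb _ (hmem b)).1 (hb _ (hmem b)).2
  rw [hcoeff] at hquot
  linarith [sum_abs_realOrder_mul_abs_log_sub_le R hβ hβ₁ ha hb]

theorem eventually_mul_one_add_log_div_le_rpow (C : ℝ) {θ : ℝ} (hθ : θ < 1) :
    ∀ᶠ R : ℝ in atTop, C * (1 + 2 * Real.log (16 * R)) / R ≤ 4⁻¹ * R ^ (-θ) := by
  have hone : (fun _ : ℝ ↦ (1 + 2 * Real.log 16 : ℝ)) =o[atTop] fun R ↦ R ^ (1 - θ) :=
    Asymptotics.isLittleO_const_left.2 <| Or.inr <|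
      tendsto_norm_atTop_atTop.comp (tendsto_rpow_atTop (sub_pos.2 hθ))
  have hlog := (isLittleO_log_rpow_atTop (sub_pos.2 hθ)).const_mul_left 2
  filter_upwards [((hone.add hlog).const_mul_left C).bound (show (0 : ℝ) < 4⁻¹ by norm_num),
    eventually_gt_atTop 0] with R hR hR₀
  rw [Real.norm_of_nonneg (Real.rpow_nonneg hR₀.le _), sub_eq_neg_add,
    Real.rpow_add_one hR₀.ne', ← mul_assoc] at hR
  rw [div_le_iff₀ hR₀, Real.log_mul (by norm_num) hR₀.ne', mul_add 2, ← add_assoc]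
  exact (le_abs_self _).trans hR

theorem exists_logarithmicMeasure_setOf_le_radialPotential_le (hf : Meromorphic f) (hβ : 0 < β)
    (hβ₁ : β < 1) (θ : ℝ) {κ : ℝ} (hκ : 0 < κ) :
    ∃ C, 0 ≤ C ∧ ∀ a R, 1 ≤ R → logarithmicMeasure {t ∈ Set.Icc R (2 * R) |
        κ * (max 1 (characteristic f ⊤ (16 * R)) * R ^ (-θ)) ≤ radialPotential f (8 * R) β a t} ≤
      ENNReal.ofReal (C * R ^ (-(β - θ))) := by
  obtain ⟨K, hK, hKle⟩ := exists_circleAverage_and_sum_le_mul hf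
  have hβ' : 0 < 1 - β := sub_pos.2 hβ₁
  refine ⟨K * (1 + 2 / (1 - β)) / κ, by positivity, fun a R hR ↦ ?_⟩
  have hR₀ : 0 < R := zero_lt_one.trans_le hR
  set τ := max 1 (characteristic f ⊤ (16 * R))
  have hτ : 1 ≤ τ := le_max_left _ _
  have hsum : ∑ u ∈ zerosPoles f 0 (8 * R), |realOrder f u| ≤ K * τ :=
    (hKle (8 * R) τ (by linarith) hτ (by rw [← mul_assoc]; norm_num [τ])).2
  refine (logarithmicMeasure_setOf_le_radialPotential_le f a hR₀ hβ hβ₁ (by positivity)).trans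
    (ENNReal.ofReal_le_ofReal ?_)
  calc _ ≤ K * τ * (1 + 2 / (1 - β)) * R ^ (-β) / (κ * (τ * R ^ (-θ))) := by gcongr
    _ = K * (1 + 2 / (1 - β)) / κ * R ^ (-(β - θ)) := by
      rw [neg_sub', Real.rpow_sub hR₀]
      field_simp

theorem eventually_circleAverage_add_log_mul_sum_le (hf : Meromorphic f) {θ : ℝ} (hθ : θ < 1)
    {d : ℝ} (hd : 0 ≤ d) :
    ∀ᶠ R in atTop, d / R * (Real.circleAverage (fun z ↦ |Real.log ‖f z‖|) 0 (8 * R) +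
        2 * Real.log (2 * (8 * R)) * ∑ u ∈ zerosPoles f 0 (8 * R), |realOrder f u|) ≤
      4⁻¹ * (max 1 (characteristic f ⊤ (16 * R)) * R ^ (-θ)) := by
  obtain ⟨K, _, hKle⟩ := exists_circleAverage_and_sum_le_mul hf
  filter_upwards [eventually_mul_one_add_log_div_le_rpow (d * K) hθ, eventually_ge_atTop 1]
    with R hfar hR
  set τ := max 1 (characteristic f ⊤ (16 * R))
  have hτ : 1 ≤ τ := le_max_left _ _
  have hmul : 2 * (8 * R) = 16 * R := by ring
  obtain ⟨havg, hsum⟩ := hKle (8 * R) τ (by linarith) hτ (by rw [hmul]; exact le_max_right _ _)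
  have hlog : 0 ≤ Real.log (16 * R) := Real.log_nonneg (by linarith)
  rw [hmul]
  calc _ ≤ d / R * (K * τ + 2 * Real.log (16 * R) * (K * τ)) := by gcongr
    _ = τ * (d * K * (1 + 2 * Real.log (16 * R)) / R) := by ring
    _ ≤ τ * (4⁻¹ * R ^ (-θ)) := by gcongr
    _ = 4⁻¹ * (τ * R ^ (-θ)) := by ring

theorem max_characteristic_mul_rpow_le (hf : Meromorphic f) {R r θ : ℝ} (hR : 0 < R) (hRr : R ≤ r)
    (hr : r ≤ 2 * R) (hθ₀ : 0 ≤ θ) (hθ : θ ≤ 1) :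
    2⁻¹ * (max 1 (characteristic f ⊤ (16 * R)) * R ^ (-θ)) ≤
      max 1 (characteristic f ⊤ (16 * r)) * r ^ (-θ) := by
  have hpow : 2⁻¹ * R ^ (-θ) ≤ r ^ (-θ) :=
    calc 2⁻¹ * R ^ (-θ) ≤ 2 ^ (-θ) * R ^ (-θ) := by
          gcongr
          rw [← Real.rpow_neg_one]
          exact Real.rpow_le_rpow_of_exponent_le one_le_two (neg_le_neg hθ)
      _ = (2 * R) ^ (-θ) := (Real.mul_rpow zero_le_two hR.le).symm
      _ ≤ r ^ (-θ) := Real.rpow_le_rpow_of_nonpos (hR.trans_le hRr) hr (neg_nonpos.2 hθ₀)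
  rw [mul_left_comm]
  have hmono : characteristic f ⊤ (16 * R) ≤ characteristic f ⊤ (16 * r) :=
    characteristic_monotoneOn hf (show 0 < 16 * R by linarith) (show 0 < 16 * r by linarith)
      (by linarith)
  gcongr

theorem eventually_log_norm_shift_sub_le_of_radialPotential_lt (hf : Meromorphic f)
    (hf₀ : ∀ z, meromorphicOrderAt f z ≠ ⊤) {θ : ℝ} (hθ₀ : 0 ≤ θ) (hθ : θ < 1) (hβ : 0 < β)
    (hβ₁ : β ≤ 1) (hab : a ≠ b) :
    ∀ᶠ R in atTop, ∀ z : ℂ, ‖z‖ ∈ Set.Icc R (2 * R) →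
      (∀ e ∈ ({a, b} : Set ℂ), (∀ u ∈ sphere e ‖z‖, AnalyticAt ℂ f u ∧ f u ≠ 0) ∧
        radialPotential f (8 * R) β e ‖z‖ < (8 * (‖a - b‖ ^ β / β))⁻¹ *
          (max 1 (characteristic f ⊤ (16 * R)) * R ^ (-θ))) →
      Real.log ‖f (z + a)‖ - Real.log ‖f (z + b)‖ ≤
        max 1 (characteristic f ⊤ (16 * ‖z‖)) * ‖z‖ ^ (-θ) := by
  have hd : 0 < ‖a - b‖ := norm_sub_pos_iff.2 hab
  set L := ‖a - b‖ ^ β / β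
  have hL : 0 < L := by positivity
  filter_upwards [eventually_circleAverage_add_log_mul_sum_le hf hθ hd.le,
    eventually_ge_atTop (max 1 (max ‖a‖ ‖b‖))] with R hfar hR z hz hz'
  obtain ⟨hR₁, hRab⟩ := max_le_iff.1 hR
  obtain ⟨haR, hbR⟩ := max_le_iff.1 hRab
  have hpot {e : ℂ} (he : e ∈ ({a, b} : Set ℂ)) : L * radialPotential f (8 * R) β e ‖z‖ ≤
      8⁻¹ * (max 1 (characteristic f ⊤ (16 * R)) * R ^ (-θ)) := by
    rw [← le_div_iff₀' hL]
    refine (hz' e he).2.le.trans_eq ?_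
    rw [mul_inv]
    ring
  have ha : a ∈ ({a, b} : Set ℂ) := Or.inl rfl
  have hb : b ∈ ({a, b} : Set ℂ) := Or.inr rfl
  have hquot := log_norm_shift_sub_le hf hf₀ hβ hβ₁ (show 1 ≤ 8 * R by linarith)
    (by linarith [hz.2]) (by linarith [hz.2]) (hz' a ha).1 (hz' b hb).1
  rw [mul_div_mul_left _ _ (by norm_num), mul_add] at hquot
  linarith [hpot ha, hpot hb, max_characteristic_mul_rpow_le hf (by linarith) hz.1 hz.2 hθ₀ hθ.le]

theorem eventually_log_norm_shift_sub_le (hf : Meromorphic f)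
    (hf₀ : ∀ z, meromorphicOrderAt f z ≠ ⊤) {θ : ℝ} (hθ₀ : 0 ≤ θ) (hθ : θ < 1) (a b : ℂ) :
    ∀ᶠ z in offFiniteLogMeasure, Real.log ‖f (z + a)‖ - Real.log ‖f (z + b)‖ ≤
      max 1 (characteristic f ⊤ (16 * ‖z‖)) * ‖z‖ ^ (-θ) := by
  rcases eq_or_ne a b with rfl | hab
  · refine .of_forall fun z ↦ ?_
    rw [sub_self]
    positivity
  obtain ⟨β, hθβ, hβ₁⟩ := exists_between hθ
  have hβ : 0 < β := hθ₀.trans_lt hθβ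
  have hκ : 0 < (8 * (‖a - b‖ ^ β / β))⁻¹ := by
    have := norm_sub_pos_iff.2 hab
    positivity
  obtain ⟨C, hC, hS⟩ := exists_logarithmicMeasure_setOf_le_radialPotential_le hf hβ hβ₁ θ hκ
  have hSab (R : ℝ) (hR : 1 ≤ R) := (measure_union_le _ _).trans
    ((add_le_add (hS a R hR) (hS b R hR)).trans_eq (ENNReal.ofReal_add (by positivity)
      (by positivity)).symm)
  simp only [← add_mul] at hSab
  have hshift : ∀ᶠ z in offFiniteLogMeasure,
      (∀ u ∈ sphere a ‖z‖, AnalyticAt ℂ f u ∧ f u ≠ 0) →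
      (∀ u ∈ sphere b ‖z‖, AnalyticAt ℂ f u ∧ f u ≠ 0) →
      Real.log ‖f (z + a)‖ - Real.log ‖f (z + b)‖ ≤
        max 1 (characteristic f ⊤ (16 * ‖z‖)) * ‖z‖ ^ (-θ) := by
    refine eventually_offFiniteLogMeasure_of_dyadic (sub_pos.2 hθβ) hSab ?_
    filter_upwards [eventually_log_norm_shift_sub_le_of_radialPotential_lt hf hf₀ hθ₀ hθ hβ hβ₁.le
      hab] with R hR z hz hzS ha hb
    refine hR z hz ?_
    rintro e (rfl | rfl)
    · exact ⟨ha, lt_of_not_ge fun h ↦ hzS (Or.inl ⟨hz, h⟩)⟩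
    · exact ⟨hb, lt_of_not_ge fun h ↦ hzS (Or.inr ⟨hz, h⟩)⟩
  filter_upwards [hshift, eventually_analyticAt_and_ne_zero_on_sphere hf hf₀ a,
    eventually_analyticAt_and_ne_zero_on_sphere hf hf₀ b] with z hz ha hb using hz ha hb

end Shift

section IteratedExponential

theorem iterExp_succ (n : ℕ) (x : ℝ) : iterExp (n + 1) x = Real.exp (iterExp n x) :=
  Function.iterate_succ_apply' ..

theorem iterExp_succ' (n : ℕ) (x : ℝ) : iterExp (n + 1) x = iterExp n (Real.exp x) :=
  Function.iterate_succ_apply ..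

theorem iterLog_succ (n : ℕ) (x : ℝ) : iterLog (n + 1) x = Real.log (iterLog n x) :=
  Function.iterate_succ_apply' ..

theorem iterLog_succ' (n : ℕ) (x : ℝ) : iterLog (n + 1) x = iterLog n (Real.log x) :=
  Function.iterate_succ_apply ..

theorem iterExp_monotone (n : ℕ) : Monotone (iterExp n) := Real.exp_monotone.iterate n

theorem le_iterExp (n : ℕ) (x : ℝ) : x ≤ iterExp n x :=
  Function.id_le_iterate_of_id_le (fun y ↦ (lt_add_one y).le.trans (Real.add_one_le_exp y)) n x

theorem tendsto_iterLog_atTop (n : ℕ) : Tendsto (iterLog n) atTop atTop :=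
  Real.tendsto_log_atTop.iterate n

theorem four_mul_exp_le_exp {x y : ℝ} (h : x + 2 ≤ y) : 4 * Real.exp x ≤ Real.exp y := by
  have hfour : (4 : ℝ) ≤ Real.exp 2 := by
    linarith [Real.quadratic_le_exp_of_nonneg (zero_le_two (α := ℝ))]
  calc 4 * Real.exp x ≤ Real.exp 2 * Real.exp x := by gcongr
    _ = Real.exp (x + 2) := by rw [add_comm, Real.exp_add]
    _ ≤ Real.exp y := Real.exp_le_exp.2 h

theorem iterExp_add_two_le (n : ℕ) {x y : ℝ} (hx : 0 ≤ x) (h : x + 2 ≤ y) :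
    iterExp n x + 2 ≤ iterExp n y := by
  induction n with
  | zero => exact h
  | succ n ih =>
    rw [iterExp_succ, iterExp_succ]
    have hone : 1 ≤ Real.exp (iterExp n x) := Real.one_le_exp (hx.trans (le_iterExp n x))
    linarith [four_mul_exp_le_exp ih]

theorem lt_iterExp_of_iterLog_lt (n : ℕ) {x y : ℝ} (h : iterLog n x < y) : x < iterExp n y := by
  induction n generalizing x with
  | zero => exact h
  | succ n ih =>
    rw [iterLog_succ'] at h
    rw [iterExp_succ]
    rcases le_or_gt x 0 with hx | hx
    · exact hx.trans_lt (Real.exp_pos _)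
    · exact (Real.log_lt_iff_lt_exp hx).1 (ih h)

theorem eventually_iterLog_mul_le (n : ℕ) {c : ℝ} (hc : 1 ≤ c) :
    ∀ᶠ r in atTop, iterLog n (c * r) ≤ c * iterLog n r := by
  have hc₀ : 0 < c := one_pos.trans_le hc
  induction n with
  | zero => exact .of_forall fun r ↦ le_rfl
  | succ n ih =>
    filter_upwards [ih, (tendsto_iterLog_atTop n).eventually_gt_atTop 0,
      ((tendsto_iterLog_atTop n).comp (tendsto_id.const_mul_atTop hc₀)).eventually_gt_atTop 0,
      (tendsto_iterLog_atTop (n + 1)).eventually_ge_atTop 1] with r hle hr hcr hone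
    rw [iterLog_succ] at hone ⊢
    rw [iterLog_succ]
    calc Real.log (iterLog n (c * r)) ≤ Real.log (c * iterLog n r) := Real.log_le_log hcr hle
      _ = Real.log c + Real.log (iterLog n r) := Real.log_mul hc₀.ne' hr.ne'
      _ ≤ c * Real.log (iterLog n r) := by nlinarith [Real.log_le_sub_one_of_pos hc₀]

end IteratedExponential

section Order

open ValueDistribution

variable {n m : ℕ} {f : ℂ → ℂ} {t : ℝ}

theorem eventually_characteristic_le_of_pqOrder_lt
    (h : pqOrder (n + 1) (m + 1) f < (t : EReal)) :
    ∀ᶠ r in atTop, characteristic f ⊤ r ≤ iterExp n (iterLog m r ^ t) := by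
  filter_upwards [eventually_lt_of_limsup_lt h,
    (tendsto_iterLog_atTop (m + 1)).eventually_gt_atTop 0,
    (tendsto_iterLog_atTop m).eventually_gt_atTop 0] with r hlt hlog hpos
  have hT := lt_iterExp_of_iterLog_lt _ ((div_lt_iff₀ hlog).1 (EReal.coe_lt_coe_iff.1 hlt))
  rw [iterExp_succ', iterLog_succ, mul_comm, ← Real.rpow_def_of_pos hpos] at hT
  exact hT.le

theorem eventually_max_one_characteristic_mul_le {c : ℝ} (hc : 1 ≤ c) (ht : 0 ≤ t)
    (h : pqOrder (n + 1) (m + 1) f < (t : EReal)) :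
    ∀ᶠ r in atTop,
      max 1 (characteristic f ⊤ (c * r)) ≤ iterExp n (c ^ t * iterLog m r ^ t) := by
  have hmul : Tendsto (fun r : ℝ ↦ c * r) atTop atTop :=
    tendsto_id.const_mul_atTop (one_pos.trans_le hc)
  filter_upwards [hmul.eventually (eventually_characteristic_le_of_pqOrder_lt h),
    eventually_iterLog_mul_le m hc, (tendsto_iterLog_atTop m).eventually_ge_atTop 1,
    ((tendsto_iterLog_atTop m).comp hmul).eventually_ge_atTop 0] with r hT hle hone hnonneg
  rw [← Real.mul_rpow (by positivity) (by positivity)]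
  refine max_le ((Real.one_le_rpow (one_le_mul_of_one_le_of_one_le hc hone) ht).trans
    (le_iterExp n _)) (hT.trans (iterExp_monotone n ?_))
  exact Real.rpow_le_rpow hnonneg hle ht

theorem eventually_mul_rpow_add_lt {u s ε : ℝ} (hus : u < s) (hs : 0 < s) (hε : 0 < ε)
    (K C : ℝ) : ∀ᶠ x : ℝ in atTop, K * x ^ u + C < ε * x ^ s := by
  have hlim : Tendsto (fun x : ℝ ↦ K * x ^ (-(s - u)) + C * x ^ (-s)) atTop (𝓝 0) := by
    simpa using ((tendsto_rpow_neg_atTop (sub_pos.2 hus)).const_mul K).add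
      ((tendsto_rpow_neg_atTop hs).const_mul C)
  filter_upwards [hlim.eventually_lt_const hε, eventually_gt_atTop 0] with x hx hx₀
  calc K * x ^ u + C = (K * x ^ (-(s - u)) + C * x ^ (-s)) * x ^ s := by
        rw [add_mul, mul_assoc, mul_assoc, ← Real.rpow_add hx₀, ← Real.rpow_add hx₀]
        simp
    _ < ε * x ^ s := by gcongr

theorem eventually_iterExp_add_iterExp_add_lt (n : ℕ) {a b s : ℝ} (ha : 0 < a) (hab : b < a)
    (hs : 0 < s) (hts : t < s) (K C : ℝ) :
    ∀ᶠ x : ℝ in atTop, iterExp (n + 1) (b * x ^ s) + iterExp (n + 1) (K * x ^ t) + C <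
      iterExp (n + 1) (a * x ^ s) := by
  obtain ⟨a', ha', haa'⟩ := exists_between (max_lt ha hab)
  obtain ⟨ha'₀, hba'⟩ := max_lt_iff.1 ha'
  have hpow : Tendsto (fun x : ℝ ↦ x ^ s) atTop atTop := tendsto_rpow_atTop hs
  filter_upwards [eventually_mul_rpow_add_lt hts hs ha'₀ K 0, eventually_ge_atTop 0,
    (hpow.const_mul_atTop ha'₀).eventually_ge_atTop C,
    (hpow.const_mul_atTop (sub_pos.2 haa')).eventually_ge_atTop 2] with x hK hx hC htwo
  set E := iterExp (n + 1) (a' * x ^ s) with hE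
  have hEpos : 0 < E := by
    rw [hE, iterExp_succ]
    exact Real.exp_pos _
  have hKE : iterExp (n + 1) (K * x ^ t) ≤ E := iterExp_monotone _ (by linarith)
  have hCE : C ≤ E := hC.trans (le_iterExp _ _)
  have hbE : iterExp (n + 1) (b * x ^ s) ≤ E := iterExp_monotone _ (by gcongr)
  have hEa : 4 * E ≤ iterExp (n + 1) (a * x ^ s) := by
    rw [hE, iterExp_succ, iterExp_succ]
    exact four_mul_exp_le_exp (iterExp_add_two_le n (by positivity) (by linarith))
  linarith

end Order

section Dominance

theorem le_add_log_card_of_sum_mul_eq_zero {ι 𝕜 : Type*} [Fintype ι] [NormedDivisionRing 𝕜]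
    {A x : ι → 𝕜} {l : ι} {α γ Y : ℝ} (hsum : ∑ j, A j * x j = 0) (hα : Real.exp α ≤ ‖A l‖)
    (hγ : ∀ j, j ≠ l → ‖A j‖ ≤ Real.exp γ) (hx : ∀ j, x j ≠ 0)
    (hY : ∀ j, Real.log ‖x j‖ - Real.log ‖x l‖ ≤ Y) :
    α ≤ γ + Y + Real.log (Fintype.card ι) := by
  classical
  have : Nonempty ι := ⟨l⟩
  have hlog (j : ι) : Real.exp (Real.log ‖x j‖) = ‖x j‖ := Real.exp_log (norm_pos_iff.2 (hx j))
  have hterm (j : ι) (hj : j ≠ l) : ‖A j * x j‖ ≤ Real.exp (γ + Y + Real.log ‖x l‖) := by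
    rw [norm_mul, ← hlog j, add_assoc, Real.exp_add]
    gcongr
    · exact hγ j hj
    · linarith [hY j]
  have hl : A l * x l = -∑ j ∈ Finset.univ.erase l, A j * x j := by
    rw [← Finset.add_sum_erase _ _ (Finset.mem_univ l)] at hsum
    exact eq_neg_of_add_eq_zero_left hsum
  have hexp : Real.exp (α + Real.log ‖x l‖) ≤
      Real.exp (γ + Y + Real.log (Fintype.card ι) + Real.log ‖x l‖) :=
    calc Real.exp (α + Real.log ‖x l‖) = Real.exp α * ‖x l‖ := by rw [Real.exp_add, hlog]
      _ ≤ ‖A l‖ * ‖x l‖ := by gcongr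
      _ = ‖∑ j ∈ Finset.univ.erase l, A j * x j‖ := by rw [← norm_mul, hl, norm_neg]
      _ ≤ ∑ _j ∈ Finset.univ.erase l, Real.exp (γ + Y + Real.log ‖x l‖) :=
          norm_sum_le_of_le _ fun j hj ↦ hterm j (Finset.ne_of_mem_erase hj)
      _ ≤ ∑ _j : ι, Real.exp (γ + Y + Real.log ‖x l‖) :=
          Finset.sum_le_sum_of_subset_of_nonneg (Finset.erase_subset _ _) fun _ _ _ ↦ by positivity
      _ = Fintype.card ι * Real.exp (γ + Y + Real.log ‖x l‖) := by simp
      _ = _ := by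
          rw [add_right_comm (γ + Y), Real.exp_add _ (Real.log (Fintype.card ι)),
            Real.exp_log (by positivity), mul_comm]
  linarith [Real.exp_le_exp.1 hexp]

theorem meromorphicOrderAt_ne_top_of_not_eventuallyEq_zero {f : ℂ → ℂ} (hf : Meromorphic f)
    (h : ¬ f =ᶠ[codiscrete ℂ] 0) (z : ℂ) : meromorphicOrderAt f z ≠ ⊤ := by
  refine hf.exists_meromorphicOrderAt_ne_top_iff_forall.1 ?_ z
  by_contra! htop
  refine h (mem_codiscrete.2 fun x ↦ ?_)
  rw [disjoint_principal_right, compl_compl]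
  exact meromorphicOrderAt_eq_top_iff.1 (htop x)

open ValueDistribution

variable {k : ℕ} {c : Fin (k + 1) → ℂ} {A : Fin (k + 1) → ℂ → ℂ} {D : Set ℂ} {l : Fin (k + 1)}
  {a b s : ℝ} {f : ℂ → ℂ}

theorem frequently_iterExp_le_of_dominantOn {n m : ℕ} (hD : 0 < upperLogDensity (norm '' D))
    (hdom : DominantOn (n + 1) (m + 1) A l D a b s) (hsol : IsDifferenceSolution A c f)
    (hf₀ : ¬ f =ᶠ[codiscrete ℂ] 0) {θ : ℝ} (hθ₀ : 0 ≤ θ) (hθ : θ < 1) :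
    ∃ᶠ r : ℝ in atTop, iterExp n (a * iterLog m r ^ s) ≤ iterExp n (b * iterLog m r ^ s) +
      max 1 (characteristic f ⊤ (16 * r)) * r ^ (-θ) + Real.log (k + 1) := by
  obtain ⟨hf, heq⟩ := hsol
  have horder := meromorphicOrderAt_ne_top_of_not_eventuallyEq_zero hf hf₀
  have := neBot_offFiniteLogMeasure_inf_principal hD
  have hle : offFiniteLogMeasure ⊓ 𝓟 D ≤ offFiniteLogMeasure := inf_le_left
  have hnorm : Tendsto norm (offFiniteLogMeasure ⊓ 𝓟 D) (atTop : Filter ℝ) :=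
    tendsto_norm_cobounded_atTop.mono_left (hle.trans offFiniteLogMeasure_le_cobounded)
  have hshift : ∀ᶠ z in offFiniteLogMeasure, ∀ j,
      Real.log ‖f (z + c j)‖ - Real.log ‖f (z + c l)‖ ≤
        max 1 (characteristic f ⊤ (16 * ‖z‖)) * ‖z‖ ^ (-θ) :=
    eventually_all.2 fun j ↦ eventually_log_norm_shift_sub_le hf horder hθ₀ hθ (c j) (c l)
  have hne : ∀ᶠ z in offFiniteLogMeasure, ∀ j, f (z + c j) ≠ 0 := by
    refine eventually_all.2 fun j ↦ ?_
    filter_upwards [eventually_analyticAt_and_ne_zero_on_sphere hf horder (c j)] with z hz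
    exact (hz (z + c j) (by rw [mem_sphere_iff_norm, add_sub_cancel_right])).2
  refine hnorm.frequently (Eventually.frequently ?_)
  filter_upwards [hle hshift, hle hne, hle (offFiniteLogMeasure_le_codiscrete heq),
    inf_le_inf_right _ offFiniteLogMeasure_le_cobounded hdom] with z hY hx hsum hA
  simp only [Nat.add_sub_cancel, iterExp_succ] at hA
  simpa using le_add_log_card_of_sum_mul_eq_zero hsum hA.1 hA.2 hx hY

theorem add_one_le_pqOrder_of_dominantOn (hD : 0 < upperLogDensity (norm '' D)) (hs : 0 < s)
    (hab : b < a) (hdom : DominantOn 1 1 A l D a b s) (hsol : IsDifferenceSolution A c f)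
    (hf₀ : ¬ f =ᶠ[codiscrete ℂ] 0) : ((s + 1 : ℝ) : EReal) ≤ pqOrder 1 1 f := by
  by_contra! hlt
  obtain ⟨t, ht, hts⟩ := EReal.lt_iff_exists_real_btwn.1
    (max_lt hlt (EReal.coe_pos.2 (by positivity : 0 < s + 1)))
  obtain ⟨hft, ht₀⟩ := max_lt_iff.1 ht
  obtain ⟨θ, hθ', hθ⟩ := exists_between
    (max_lt one_pos (by linarith [EReal.coe_lt_coe_iff.1 hts] : t - s < 1))
  obtain ⟨hθ₀, htθ⟩ := max_lt_iff.1 hθ'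
  refine frequently_iterExp_le_of_dominantOn hD hdom hsol hf₀ hθ₀.le hθ ?_
  filter_upwards [eventually_max_one_characteristic_mul_le (c := 16) (by norm_num)
    (EReal.coe_pos.1 ht₀).le hft, eventually_gt_atTop 0,
    eventually_mul_rpow_add_lt (by linarith : t - θ < s) hs (sub_pos.2 hab) (16 ^ t)
      (Real.log (k + 1))] with r hT hr hlt
  simp only [iterExp, iterLog, Function.iterate_zero, id] at hT ⊢
  have hTθ : max 1 (characteristic f ⊤ (16 * r)) * r ^ (-θ) ≤ 16 ^ t * r ^ (t - θ) := by
    rw [sub_eq_add_neg, Real.rpow_add hr, ← mul_assoc]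
    gcongr
  linarith

theorem le_pqOrder_of_dominantOn {p q : ℕ} (hp : 2 ≤ p) (hq : 1 ≤ q)
    (hD : 0 < upperLogDensity (norm '' D)) (hs : 0 < s) (ha : 0 < a) (hab : b < a)
    (hdom : DominantOn p q A l D a b s) (hsol : IsDifferenceSolution A c f)
    (hf₀ : ¬ f =ᶠ[codiscrete ℂ] 0) : (s : EReal) ≤ pqOrder p q f := by
  obtain ⟨n, rfl⟩ := Nat.exists_eq_add_of_le' hp
  obtain ⟨m, rfl⟩ := Nat.exists_eq_add_of_le' hq
  by_contra! hlt
  obtain ⟨t, ht, hts⟩ := EReal.lt_iff_exists_real_btwn.1 (max_lt hlt (EReal.coe_pos.2 hs))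
  obtain ⟨hft, ht₀⟩ := max_lt_iff.1 ht
  refine frequently_iterExp_le_of_dominantOn hD hdom hsol hf₀ le_rfl one_pos ?_
  filter_upwards [eventually_max_one_characteristic_mul_le (c := 16) (by norm_num)
    (EReal.coe_pos.1 ht₀).le hft, (tendsto_iterLog_atTop m).eventually
      (eventually_iterExp_add_iterExp_add_lt n ha hab hs (EReal.coe_lt_coe_iff.1 hts) (16 ^ t)
        (Real.log (k + 1)))] with r hT hlt
  rw [neg_zero, Real.rpow_zero, mul_one]
  linarith

end Dominance

theorem exists_pos_forall_coe_le_of_coe_sub_le (ρ : ℝ) :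
    ∃ δ₀ : EReal → ℝ, (∀ σ, 0 < δ₀ σ) ∧
      ∀ σ δ, δ < δ₀ σ → ((ρ - δ : ℝ) : EReal) ≤ σ → (ρ : EReal) ≤ σ := by
  have hgap (σ : EReal) :
      ∃ ε : ℝ, 0 < ε ∧ ∀ δ < ε, ((ρ - δ : ℝ) : EReal) ≤ σ → (ρ : EReal) ≤ σ := by
    rcases le_or_gt (ρ : EReal) σ with hρ | hσ
    · exact ⟨1, one_pos, fun _ _ _ ↦ hρ⟩
    obtain ⟨t, hσt, htρ⟩ := EReal.lt_iff_exists_real_btwn.1 hσ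
    refine ⟨ρ - t, sub_pos.2 (EReal.coe_lt_coe_iff.1 htρ), fun δ hδ hle ↦ ?_⟩
    linarith [EReal.coe_lt_coe_iff.1 (hle.trans_lt hσt)]
  choose δ₀ hpos hδ₀ using hgap
  exact ⟨δ₀, hpos, hδ₀⟩

theorem mainTheorem1_general (p q : ℕ) (ρ : ℝ) :
    ∃ δ₀ : EReal → ℝ, (∀ σ, 0 < δ₀ σ) ∧
      ∀ (k : ℕ) (c : Fin (k + 1) → ℂ) (A : Fin (k + 1) → ℂ → ℂ) (D : Set ℂ) (l : Fin (k + 1))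
        (a b δ : ℝ), 0 < upperLogDensity (norm '' D) → 0 < a → b < a → δ < ρ →
        DominantOn p q A l D a b (ρ - δ) →
        ∀ f : ℂ → ℂ, IsDifferenceSolution A c f → ¬ f =ᶠ[codiscrete ℂ] 0 →
          δ < δ₀ (pqOrder p q f) →
          (p = 1 → q = 1 → (ρ : EReal) + 1 ≤ pqOrder p q f) ∧
          (2 ≤ p → 1 ≤ q → (ρ : EReal) ≤ pqOrder p q f) := by
  obtain ⟨δ₁, hδ₁, hgap₁⟩ := exists_pos_forall_coe_le_of_coe_sub_le (ρ + 1)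
  obtain ⟨δ₂, hδ₂, hgap₂⟩ := exists_pos_forall_coe_le_of_coe_sub_le ρ
  refine ⟨fun σ ↦ min (δ₁ σ) (δ₂ σ), fun σ ↦ lt_min (hδ₁ σ) (hδ₂ σ), ?_⟩
  intro k c A D l a b δ hD ha hab hδρ hdom f hsol hf₀ hδ
  have hs : 0 < ρ - δ := sub_pos.2 hδρ
  refine ⟨?_, fun hp hq ↦ hgap₂ _ δ (hδ.trans_le (min_le_right ..))
    (le_pqOrder_of_dominantOn hp hq hD hs ha hab hdom hsol hf₀)⟩
  rintro rfl rfl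
  refine hgap₁ _ δ (hδ.trans_le (min_le_left ..)) ?_
  rw [add_sub_right_comm]
  exact add_one_le_pqOrder_of_dominantOn hD hs hab hdom hsol hf₀

theorem mainTheorem1 (p q : ℕ) (ρ : ℝ) :
    ∃ δ₀ : EReal → ℝ, (∀ σ, 0 < δ₀ σ) ∧
      ∀ (k : ℕ) (c : Fin (k + 1) → ℂ) (A : Fin (k + 1) → ℂ → ℂ) (D : Set ℂ) (l : Fin (k + 1))
        (a b δ : ℝ),
        c 0 = 0 → Function.Injective c →
        0 < upperLogDensity ((fun z : ℂ => ‖z‖) '' D) →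
        (∀ j, Differentiable ℂ (A j)) → (∀ j, pqOrder p q (A j) ≤ (ρ : EReal)) →
        0 ≤ b → b < a → 0 < δ → δ < ρ →
        DominantOn p q A l D a b (ρ - δ) →
        ∀ f : ℂ → ℂ, IsDifferenceSolution A c f → ¬ f =ᶠ[codiscrete ℂ] 0 →
          δ < δ₀ (pqOrder p q f) →
          (p = 1 → q = 1 → pqOrder p q (A l) + 1 ≤ pqOrder p q f) ∧
          (2 ≤ q → q ≤ p → pqOrder p q (A l) ≤ pqOrder p q f) := by
  obtain ⟨δ₀, hpos, h⟩ := mainTheorem1_general p q ρ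
  refine ⟨δ₀, hpos, fun k c A D l a b δ _ _ hD _ hA hb hab _ hδρ hdom f hsol hf₀ hδ ↦ ?_⟩
  obtain ⟨h₁, h₂⟩ := h k c A D l a b δ hD (hb.trans_lt hab) hab hδρ hdom f hsol hf₀ hδ
  exact ⟨fun hp hq ↦ (add_le_add_left (hA l) 1).trans (h₁ hp hq),
    fun hq hqp ↦ (hA l).trans (h₂ (hq.trans hqp) (one_le_two.trans hq))⟩
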